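/- In the Feedback MAB problem there are $n$ independent arms; arm $i$ follows a two-state Markov chain (good $g$, bad $b$) with $\Pr[b\to g]=\alpha_i>0$, $\Pr[g\to b]=\beta_i>0$, $\alpha_i+\beta_i<1$, which evolves whether or not the arm is played. In each step a policy plays at most one arm, chosen (possibly at random) from its past actions and observations; playing arm $i$ reveals its current state and yields $r_i\ge 0$ if that state is good, and $0$ otherwise. The goal is to maximize the infinite horizon average reward $\limsup_{T\to\infty}\frac1T\,\mathbb E[\text{total reward in the first }T\text{ steps}]$; let $\mathrm{POL}$ be its supremum over all policies. Let $v_{it}$ (resp. $u_{it}$) be the probability that arm $i$ is good $t$ steps after it was observed to be bad (resp. good). Whittle's LP, with value $\mathrm{LP}$, is: maximize $\sum_i\sum_{t\ge1} r_i x^i_{gt}$ over $x^i_{st}\ge 0$ ($s\in\{g,b\}$, $t\ge 1$) subject to $$\sum_{i}\sum_{s}\sum_{t\ge1}x^i_{st}=1,\qquad \sum_{s}\sum_{t\ge1}t\,x^i_{st}\le1\ \ \forall i,\qquad \sum_{t\ge1}x^i_{bt}v_{it}=\sum_{t\ge1}x^i_{gt}(1-u_{it})\ \ \forall i.$$ **Theorem.**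 The gap $\mathrm{LP}/\mathrm{POL}$ can be arbitrarily close to $e/(e-1)$. More precisely, for $n\ge2$ and $\beta>0$ with $n\beta<n-1$, consider $n$ identical arms with $\beta_i=\beta$, $\alpha_i=\beta/(n-1)$ and $r_i=1$, with any distribution of the initial joint state. Then: 1. For every $\varepsilon>0$ there are $N$ and $\kappa>0$ such that $\left|\mathrm{LP}/\mathrm{POL}-\frac{e}{e-1}\right|<\varepsilon$ whenever $n\ge N$ and $n\beta<\kappa$. 2. There is an absolute constant $C>0$ such that $1-C\sqrt{n\beta}\le\mathrm{LP}\le1$ for all such $n,\beta$ (so $\mathrm{LP}=1-o(1)$ as $n\beta\to0$). 3. Every policy has average reward at most $1-(1-1/n)^n$, and $\mathrm{POL}>0$. 4. $1-(1-1/n)^n\to1-1/e$ as $n\to\infty$. -/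

import Mathlib

/-- An instance of the Feedback MAB problem with `n` arms. Each arm carries a two-state Markov chain
(`true` is the good state, `false` the bad state) that evolves whether or not the arm is played;
`α i` is the probability of moving from bad to good, `β i` that of moving from good to bad, and
`r i` is the reward of a play in the good state. Since there are finitely many arms, `bursty` says
that `α i + β i ≤ 1 - δ` for all `i` and some `δ > 0`. -/
structure FeedbackMAB (n : ℕ) where
  α : Fin n → ℝ
  β : Fin n → ℝ
  r : Fin n → ℝ
  α_pos : ∀ i, 0 < α i
  β_pos : ∀ i, 0 < β i
  r_nonneg : ∀ i, 0 ≤ r i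
  bursty : ∀ i, α i + β i < 1

namespace FeedbackMAB

variable {n : ℕ}

/-- The one-step transition matrix of arm `i`. -/
def transMatrix (I : FeedbackMAB n) (i : Fin n) : Matrix Bool Bool ℝ :=
  Matrix.of fun s s' =>
    match s, s' with
    | false, true => I.α i
    | false, false => 1 - I.α i
    | true, false => I.β i
    | true, true => 1 - I.β i

/-- `v i t`: probability that arm `i` is good, `t` steps after it was observed in the bad state. -/
noncomputable def v (I : FeedbackMAB n) (i : Fin n) (t : ℕ) : ℝ :=
  (I.transMatrix i ^ t) false true

/-- `u i t`: probability that arm `i` is good, `t` steps after it was observed in the good state. -/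
noncomputable def u (I : FeedbackMAB n) (i : Fin n) (t : ℕ) : ℝ :=
  (I.transMatrix i ^ t) true true

/-! ### Whittle's linear program -/

/-- Feasible solutions `x i s t` (`t ≥ 1`) of Whittle's LP. -/
structure WhittleFeasible (I : FeedbackMAB n) (x : Fin n → Bool → ℕ+ → ℝ) : Prop where
  nonneg : ∀ i s t, 0 ≤ x i s t
  /-- the series below converge (as `t ≥ 1` and `x ≥ 0`, this makes all of them converge) -/
  summable : ∀ i s, Summable fun t : ℕ+ => (t : ℝ) * x i s t
  /-- one play per step on average -/
  plays : ∑ i, ∑ s, ∑' t : ℕ+, x i s t = 1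
  time : ∀ i, ∑ s, ∑' t : ℕ+, (t : ℝ) * x i s t ≤ 1
  balance : ∀ i, ∑' t : ℕ+, x i false t * I.v i t = ∑' t : ℕ+, x i true t * (1 - I.u i t)

/-- The objective of Whittle's LP. -/
noncomputable def whittleObjective (I : FeedbackMAB n) (x : Fin n → Bool → ℕ+ → ℝ) : ℝ :=
  ∑ i, ∑' t : ℕ+, I.r i * x i true t

/-- The objective values of the feasible solutions of Whittle's LP. -/
def whittleValues (I : FeedbackMAB n) : Set ℝ :=
  {w | ∃ x, I.WhittleFeasible x ∧ I.whittleObjective x = w}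

/-- The value of Whittle's LP. -/
noncomputable def whittleOpt (I : FeedbackMAB n) : ℝ := sSup I.whittleValues

/-! ### Policies and their average reward -/

/-- What is recorded in one step: `none` if no arm was played, and `some (i, s)` if arm `i` was
played and observed in state `s`. -/
abbrev Record (n : ℕ) : Type := Option (Fin n × Bool)

/-- A policy: from the list of all past records (the latest one first) it chooses, possibly at
random, an arm to play or (`none`) no arm. -/
abbrev Policy (n : ℕ) : Type := List (Record n) → stdSimplex ℝ (Option (Fin n))

/-- The probability that the joint state moves from `s` to `s'` in one step. -/
noncomputable def jointTrans (I : FeedbackMAB n) (s s' : Fin n → Bool) : ℝ :=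
  ∏ i, I.transMatrix i (s i) (s' i)

/-- The reward of action `a` in the joint state `s`. -/
noncomputable def reward (I : FeedbackMAB n) (a : Option (Fin n)) (s : Fin n → Bool) : ℝ :=
  match a with
  | none => 0
  | some i => if s i = true then I.r i else 0

/-- What is recorded when action `a` is taken in the joint state `s`. -/
def record (a : Option (Fin n)) (s : Fin n → Bool) : Record n :=
  a.map fun i => (i, s i)

/-- The expected total reward of policy `π` in the next `T` steps, when the past records are `h` and
the present (hidden) joint state is `s`. -/
noncomputable def totalReward (I : FeedbackMAB n) (π : Policy n) :
    ℕ → List (Record n) → (Fin n → Bool) → ℝ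
  | 0, _, _ => 0
  | T + 1, h, s => ∑ a, (π h).1 a *
      (I.reward a s + ∑ s', I.jointTrans s s' * totalReward I π T (record a s :: h) s')

/-- The expected average reward per step of `π` in the first `T` steps, from the distribution `μ` of
the initial joint state. -/
noncomputable def averageReward (I : FeedbackMAB n) (μ : stdSimplex ℝ (Fin n → Bool))
    (π : Policy n) (T : ℕ) : ℝ :=
  (∑ s, μ.1 s * I.totalReward π T [] s) / T

/-- The infinite horizon average reward of `π`; the upper limit makes it defined for all policies. -/
noncomputable def longRunReward (I : FeedbackMAB n) (μ : stdSimplex ℝ (Fin n → Bool))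
    (π : Policy n) : ℝ :=
  Filter.limsup (I.averageReward μ π) Filter.atTop

/-- The infinite horizon average reward of an optimal policy. -/
noncomputable def policyOpt (I : FeedbackMAB n) (μ : stdSimplex ℝ (Fin n → Bool)) : ℝ :=
  sSup (Set.range (I.longRunReward μ))

/-- The ratio of the value of Whittle's LP to that of an optimal policy. -/
noncomputable def gap (I : FeedbackMAB n) (μ : stdSimplex ℝ (Fin n → Bool)) : ℝ :=
  I.whittleOpt / I.policyOpt μ

/-- `n` identical arms with parameters `β`, `α = β / (n - 1)` and reward `1`. -/
noncomputable def iid (n : ℕ) (β : ℝ) (hn : 2 ≤ n) (hβ : 0 < β) (h : (n : ℝ) * β < n - 1) :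
    FeedbackMAB n where
  α := fun _ => β / ((n : ℝ) - 1)
  β := fun _ => β
  r := fun _ => 1
  α_pos := fun _ => by
    have h2 : (2 : ℝ) ≤ n := by exact_mod_cast hn
    exact div_pos hβ (by linarith)
  β_pos := fun _ => hβ
  r_nonneg := fun _ => zero_le_one
  bursty := fun _ => by
    have h2 : (2 : ℝ) ≤ n := by exact_mod_cast hn
    have h1 : (0 : ℝ) < (n : ℝ) - 1 := by linarith
    rw [div_add' _ _ _ h1.ne', div_lt_one h1]
    linarith

end FeedbackMAB

/-! With `α = β / (n - 1)` each arm is good with stationary probability `1 / n`. A step earns at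
most the indicator that some arm is good, and the arms evolve independently of the actions, so no
policy beats `1 - (1 - 1/n)^n`, which tends to `1 - 1/e` (`longRunReward_le`,
`stationaryMean_someGood`).

This bound is nearly attained when `n β` is small (`le_longRunReward_blockRule`). In blocks of `n K`
steps, spend `n` steps looking at all arms, then stay with one seen good. Exploration costs a
fraction `1 / K`. The joint state changes with stationary probability at most `2 β` per step, which
costs at most `2 K n β` on average.

The LP limits plays to one per step only on average, so it does not see that the arms may all be bad
together. Replaying a good arm at once and a bad arm after about `√(n / θ)` steps, `θ = α + β`,
makes all but a fraction `O(√(n β))` of the plays good (`exists_iid_whittleValue`). Hence LP tends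
to `1`, and the ratio to `e / (e - 1)`. -/

open Filter Topology Matrix

namespace FeedbackMAB

variable {n : ℕ}

/-! ### The Markov chain of the joint state -/

/-- The stationary distribution of arm `i`. -/
noncomputable def stationary (I : FeedbackMAB n) (i : Fin n) (b : Bool) : ℝ :=
  if b then I.α i / (I.α i + I.β i) else I.β i / (I.α i + I.β i)

theorem α_add_β_pos (I : FeedbackMAB n) (i : Fin n) : 0 < I.α i + I.β i :=
  add_pos (I.α_pos i) (I.β_pos i)

theorem stationary_pos (I : FeedbackMAB n) (i : Fin n) (b : Bool) : 0 < I.stationary i b := by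
  have h := I.α_add_β_pos i
  have hα := I.α_pos i
  have hβ := I.β_pos i
  unfold stationary
  split_ifs <;> positivity

theorem stationary_add (I : FeedbackMAB n) (i : Fin n) :
    I.stationary i true + I.stationary i false = 1 := by
  have h := (I.α_add_β_pos i).ne'
  simp only [stationary, if_true, Bool.false_eq_true, if_false]
  field_simp

theorem transMatrix_nonneg (I : FeedbackMAB n) (i : Fin n) (b b' : Bool) :
    0 ≤ I.transMatrix i b b' := by
  have hα := I.α_pos i
  have hβ := I.β_pos i
  have h := I.bursty i
  cases b <;> cases b' <;> simp only [transMatrix, Matrix.of_apply] <;> linarith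

theorem sum_transMatrix (I : FeedbackMAB n) (i : Fin n) (b : Bool) :
    ∑ b', I.transMatrix i b b' = 1 := by
  cases b <;> simp [transMatrix]

/-- The eigenvalues of the two-state chain are `1` and `1 - α - β`. The formula gives both the
convergence to the stationary law and the closed form of `v`. -/
theorem transMatrix_pow_apply (I : FeedbackMAB n) (i : Fin n) (t : ℕ) (b b' : Bool) :
    (I.transMatrix i ^ t) b b' = I.stationary i b' +
      (1 - I.α i - I.β i) ^ t * ((if b = b' then 1 else 0) - I.stationary i b') := by
  have h := (I.α_add_β_pos i).ne'
  induction t generalizing b with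
  | zero => simp [Matrix.one_apply]
  | succ t ih =>
    rw [pow_succ', Matrix.mul_apply, Fintype.sum_bool, ih, ih, pow_succ]
    cases b <;> cases b' <;>
      simp only [transMatrix, Matrix.of_apply, stationary, if_true, Bool.false_eq_true, if_false,
        reduceCtorEq] <;> field_simp <;> ring

theorem tendsto_transMatrix_pow (I : FeedbackMAB n) (i : Fin n) (b b' : Bool) :
    Tendsto (fun t : ℕ => (I.transMatrix i ^ t) b b') atTop (𝓝 (I.stationary i b')) := by
  simp only [transMatrix_pow_apply]
  have h := I.bursty i
  have h' := I.α_add_β_pos i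
  have := (tendsto_pow_atTop_nhds_zero_of_lt_one (r := 1 - I.α i - I.β i)
    (by linarith) (by linarith)).mul_const ((if b = b' then 1 else 0) - I.stationary i b')
  simpa using this.const_add (I.stationary i b')

/-- The one-step transition matrix of the joint state. -/
noncomputable def jointMatrix (I : FeedbackMAB n) : Matrix (Fin n → Bool) (Fin n → Bool) ℝ :=
  Matrix.of I.jointTrans

theorem sum_prod_eq_prod_sum (f : Fin n → Bool → ℝ) :
    ∑ s : Fin n → Bool, ∏ i, f i (s i) = ∏ i, ∑ b, f i b := by
  rw [Finset.prod_univ_sum, Fintype.piFinset_univ]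

theorem jointMatrix_pow_apply (I : FeedbackMAB n) (t : ℕ) (s s' : Fin n → Bool) :
    (I.jointMatrix ^ t) s s' = ∏ i, (I.transMatrix i ^ t) (s i) (s' i) := by
  induction t generalizing s with
  | zero =>
    simp only [pow_zero, Matrix.one_apply, funext_iff]
    exact (Finset.prod_ite_zero (s := Finset.univ) (p := fun i => s i = s' i) (f := fun _ => (1:ℝ))
      |>.trans (by simp)).symm
  | succ t ih =>
    simp only [pow_succ', Matrix.mul_apply, ih]
    rw [← sum_prod_eq_prod_sum fun i b => I.transMatrix i (s i) b * (I.transMatrix i ^ t) b (s' i)]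
    simp only [Finset.prod_mul_distrib, jointMatrix, Matrix.of_apply, jointTrans]

theorem jointTrans_nonneg (I : FeedbackMAB n) (s s' : Fin n → Bool) : 0 ≤ I.jointTrans s s' :=
  Finset.prod_nonneg fun _ _ => I.transMatrix_nonneg _ _ _

theorem sum_jointTrans (I : FeedbackMAB n) (s : Fin n → Bool) : ∑ s', I.jointTrans s s' = 1 := by
  simp only [jointTrans]
  rw [sum_prod_eq_prod_sum fun i b => I.transMatrix i (s i) b]
  exact Finset.prod_eq_one fun i _ => I.sum_transMatrix i _

/-- The mean of `f` in the stationary distribution of the joint state. -/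
noncomputable def stationaryMean (I : FeedbackMAB n) (f : (Fin n → Bool) → ℝ) : ℝ :=
  ∑ s, (∏ i, I.stationary i (s i)) * f s

theorem jointMatrix_mulVec (I : FeedbackMAB n) (f : (Fin n → Bool) → ℝ) (s : Fin n → Bool) :
    (I.jointMatrix *ᵥ f) s = ∑ s', I.jointTrans s s' * f s' := rfl

/-- The expectation of `f` after `t` steps. -/
noncomputable def expect (I : FeedbackMAB n) (t : ℕ) (f : (Fin n → Bool) → ℝ) :
    (Fin n → Bool) → ℝ :=
  I.jointMatrix ^ t *ᵥ f

theorem expect_zero (I : FeedbackMAB n) (f : (Fin n → Bool) → ℝ) : I.expect 0 f = f := by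
  simp [expect]

theorem expect_expect (I : FeedbackMAB n) (t t' : ℕ) (f : (Fin n → Bool) → ℝ) :
    I.expect t (I.expect t' f) = I.expect (t + t') f := by
  simp [expect, pow_add]

theorem sum_jointTrans_mul_expect (I : FeedbackMAB n) (t : ℕ) (f : (Fin n → Bool) → ℝ)
    (s : Fin n → Bool) :
    ∑ s', I.jointTrans s s' * I.expect t f s' = I.expect (t + 1) f s := by
  rw [← jointMatrix_mulVec, expect, expect, pow_succ', Matrix.mulVec_mulVec]

theorem tendsto_expect (I : FeedbackMAB n) (f : (Fin n → Bool) → ℝ) (s : Fin n → Bool) :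
    Tendsto (fun t => I.expect t f s) atTop (𝓝 (I.stationaryMean f)) := by
  simp only [expect, Matrix.mulVec, dotProduct, stationaryMean, jointMatrix_pow_apply]
  exact tendsto_finsetSum _ fun s' _ =>
    (tendsto_finsetProd _ fun i _ => I.tendsto_transMatrix_pow i _ _).mul_const _

/-- The Cesàro means of the expectations of `f` tend to its stationary mean. -/
theorem tendsto_cesaro_expect (I : FeedbackMAB n) (μ : stdSimplex ℝ (Fin n → Bool)) {L : ℕ}
    (hL : 0 < L) (f : (Fin n → Bool) → ℝ) :
    Tendsto (fun T : ℕ => (∑ s, μ.1 s * ∑ j ∈ Finset.range T, I.expect (j * L) f s) / T) atTop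
      (𝓝 (I.stationaryMean f)) := by
  have h : ∀ s, Tendsto (fun T : ℕ => (T⁻¹ : ℝ) * ∑ j ∈ Finset.range T, I.expect (j * L) f s)
      atTop (𝓝 (I.stationaryMean f)) := fun s =>
    -- The stride `L` is the block length for the block policy, and `1` in the other uses.
    ((I.tendsto_expect f s).comp (tendsto_id.atTop_mul_const' hL)).cesaro
  have h2 := tendsto_finsetSum Finset.univ fun s _ => (h s).const_mul (μ.1 s)
  rw [← Finset.sum_mul, μ.2.2, one_mul] at h2
  refine h2.congr fun T => ?_
  rw [Finset.sum_div]
  exact Finset.sum_congr rfl fun s _ => by ring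

/-! ### Bounds for the average reward -/

theorem averageReward_le (I : FeedbackMAB n) (μ : stdSimplex ℝ (Fin n → Bool)) (π : Policy n)
    (T : ℕ) (f : (Fin n → Bool) → ℝ) (h : ∀ s, I.totalReward π T [] s ≤ f s) :
    I.averageReward μ π T ≤ (∑ s, μ.1 s * f s) / T :=
  div_le_div_of_nonneg_right
    (Finset.sum_le_sum fun s _ => mul_le_mul_of_nonneg_left (h s) (μ.2.1 s)) T.cast_nonneg

theorem le_averageReward (I : FeedbackMAB n) (μ : stdSimplex ℝ (Fin n → Bool)) (π : Policy n)
    (T : ℕ) (f : (Fin n → Bool) → ℝ) (h : ∀ s, f s ≤ I.totalReward π T [] s) :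
    (∑ s, μ.1 s * f s) / T ≤ I.averageReward μ π T :=
  div_le_div_of_nonneg_right
    (Finset.sum_le_sum fun s _ => mul_le_mul_of_nonneg_left (h s) (μ.2.1 s)) T.cast_nonneg

theorem reward_nonneg (I : FeedbackMAB n) (a : Option (Fin n)) (s : Fin n → Bool) :
    0 ≤ I.reward a s := by
  rcases a with _ | i
  · exact le_rfl
  · simp only [reward]
    split_ifs
    exacts [I.r_nonneg i, le_rfl]

theorem totalReward_nonneg (I : FeedbackMAB n) (π : Policy n) (T : ℕ) (h : List (Record n))
    (s : Fin n → Bool) : 0 ≤ I.totalReward π T h s := by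
  induction T generalizing h s with
  | zero => exact le_rfl
  | succ T ih =>
    exact Finset.sum_nonneg fun a _ => mul_nonneg ((π h).2.1 a) (add_nonneg (I.reward_nonneg a s)
      (Finset.sum_nonneg fun s' _ => mul_nonneg (I.jointTrans_nonneg _ _) (ih _ _)))

theorem averageReward_nonneg (I : FeedbackMAB n) (μ : stdSimplex ℝ (Fin n → Bool)) (π : Policy n)
    (T : ℕ) : 0 ≤ I.averageReward μ π T :=
  div_nonneg (Finset.sum_nonneg fun s _ => mul_nonneg (μ.2.1 s) (I.totalReward_nonneg _ _ _ _))
    T.cast_nonneg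

/-- If no action has a reward above `f s` in state `s`, then the total reward is at most that of
collecting `f` in each step. -/
theorem totalReward_le (I : FeedbackMAB n) (f : (Fin n → Bool) → ℝ)
    (hf : ∀ a s, I.reward a s ≤ f s) (π : Policy n) (T : ℕ) (h : List (Record n))
    (s : Fin n → Bool) :
    I.totalReward π T h s ≤ ∑ j ∈ Finset.range T, I.expect j f s := by
  induction T generalizing h s with
  | zero => simp [totalReward]
  | succ T ih =>
    rw [Finset.sum_range_succ', expect_zero]
    -- The action alters the record but not the law of the next state, so the induction bound is the
    -- same for every action.
    calc I.totalReward π (T + 1) h s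
        ≤ ∑ a, (π h).1 a * (f s + ∑ s', I.jointTrans s s' *
            ∑ j ∈ Finset.range T, I.expect j f s') :=
          Finset.sum_le_sum fun a _ => mul_le_mul_of_nonneg_left
            (add_le_add (hf a s) (Finset.sum_le_sum fun s' _ =>
              mul_le_mul_of_nonneg_left (ih _ _) (I.jointTrans_nonneg _ _))) ((π h).2.1 a)
      _ = ∑ j ∈ Finset.range T, I.expect (j + 1) f s + f s := by
          rw [← Finset.sum_mul, (π h).2.2, one_mul, add_comm]
          simp only [Finset.mul_sum, ← sum_jointTrans_mul_expect]
          rw [Finset.sum_comm]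

/-- The policy that follows a deterministic rule. -/
noncomputable def deterministic (p : List (Record n) → Option (Fin n)) : Policy n :=
  fun h => ⟨Pi.single (p h) 1, single_mem_stdSimplex ℝ (p h)⟩

theorem totalReward_deterministic_succ (I : FeedbackMAB n)
    (p : List (Record n) → Option (Fin n)) (T : ℕ) (h : List (Record n)) (s : Fin n → Bool) :
    I.totalReward (deterministic p) (T + 1) h s = I.reward (p h) s +
      ∑ s', I.jointTrans s s' * I.totalReward (deterministic p) T (record (p h) s :: h) s' := by
  rw [totalReward, Finset.sum_eq_single (p h)]
  · simp [deterministic]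
  · intro a _ ha
    simp [deterministic, Pi.single_eq_of_ne ha]
  · simp

theorem totalReward_constant (I : FeedbackMAB n) (a : Option (Fin n)) (T : ℕ)
    (h : List (Record n)) (s : Fin n → Bool) :
    I.totalReward (deterministic fun _ => a) T h s =
      ∑ j ∈ Finset.range T, I.expect j (I.reward a) s := by
  induction T generalizing h s with
  | zero => simp [totalReward]
  | succ T ih =>
    rw [Finset.sum_range_succ', expect_zero, totalReward_deterministic_succ, add_comm]
    simp only [ih, Finset.mul_sum, ← sum_jointTrans_mul_expect]
    rw [Finset.sum_comm]

section Bounded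

variable (I : FeedbackMAB n) (f : (Fin n → Bool) → ℝ) (hf : ∀ a s, I.reward a s ≤ f s)
  (μ : stdSimplex ℝ (Fin n → Bool)) (π : Policy n)
include hf

theorem averageReward_le_cesaro (T : ℕ) : I.averageReward μ π T ≤
    (∑ s, μ.1 s * ∑ j ∈ Finset.range T, I.expect (j * 1) f s) / T := by
  simpa using I.averageReward_le μ π T _ (I.totalReward_le f hf π T [])

theorem isBoundedUnder_averageReward :
    IsBoundedUnder (· ≤ ·) atTop (I.averageReward μ π) :=
  (I.tendsto_cesaro_expect μ one_pos f).isBoundedUnder_le.mono_le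
    (Eventually.of_forall (I.averageReward_le_cesaro f hf μ π))

theorem longRunReward_le : I.longRunReward μ π ≤ I.stationaryMean f := by
  have h := I.tendsto_cesaro_expect μ one_pos f
  rw [← h.limsup_eq]
  exact limsup_le_limsup (Eventually.of_forall (I.averageReward_le_cesaro f hf μ π))
    (isCoboundedUnder_le_of_le atTop (I.averageReward_nonneg μ π)) h.isBoundedUnder_le

/-- The real `sSup` is a default value unless the set is nonempty and bounded above; this shows that
`policyOpt` is a true supremum. -/
theorem isLUB_policyOpt : IsLUB (Set.range (I.longRunReward μ)) (I.policyOpt μ) :=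
  isLUB_csSup ⟨_, deterministic fun _ => none, rfl⟩
    ⟨_, by rintro _ ⟨π, rfl⟩; exact I.longRunReward_le f hf μ π⟩

/-- An upper limit is bounded below along any subsequence, so it suffices to look at the ends of
blocks. The bound `hf` makes the averages bounded above, as the real-valued `limsup` requires. -/
theorem le_longRunReward {L : ℕ} (hL : 0 < L) (w : ℕ → ℝ) (c : ℝ) (hw : Tendsto w atTop (𝓝 c))
    (h : ∀ m, w m ≤ I.averageReward μ π (m * L)) : c ≤ I.longRunReward μ π := by
  refine le_of_forall_lt fun c' hc' => ?_
  obtain ⟨c'', h1, h2⟩ := exists_between hc'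
  refine h1.trans_le (le_limsup_of_frequently_le ?_
    (I.isBoundedUnder_averageReward f hf μ π))
  have : ∀ᶠ m : ℕ in atTop, c'' ≤ I.averageReward μ π (m * L) :=
    (hw.eventually (lt_mem_nhds h2)).mono fun m hm => hm.le.trans (h m)
  exact (tendsto_id.atTop_mul_const' hL).frequently this.frequently

theorem stationaryMean_reward_le_longRunReward (a : Option (Fin n)) :
    I.stationaryMean (I.reward a) ≤ I.longRunReward μ (deterministic fun _ => a) := by
  refine I.le_longRunReward f hf μ _ one_pos _ _
    (I.tendsto_cesaro_expect μ one_pos (I.reward a)) fun m => ?_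
  simpa using I.le_averageReward μ (deterministic fun _ => a) m _
    fun s => (I.totalReward_constant a m [] s).ge

end Bounded

/-! ### Linearity and stationarity of the mean -/

theorem expect_sum (I : FeedbackMAB n) (t : ℕ) {ι : Type*} (A : Finset ι)
    (f : ι → (Fin n → Bool) → ℝ) :
    I.expect t (∑ a ∈ A, f a) = ∑ a ∈ A, I.expect t (f a) :=
  Matrix.mulVec_sum ..

theorem stationaryMean_sub (I : FeedbackMAB n) (f g : (Fin n → Bool) → ℝ) :
    I.stationaryMean (f - g) = I.stationaryMean f - I.stationaryMean g := by
  simp only [stationaryMean, Pi.sub_apply, mul_sub, Finset.sum_sub_distrib]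

theorem stationaryMean_smul (I : FeedbackMAB n) (a : ℝ) (f : (Fin n → Bool) → ℝ) :
    I.stationaryMean (a • f) = a * I.stationaryMean f := by
  simp only [stationaryMean, Pi.smul_apply, smul_eq_mul, Finset.mul_sum, mul_left_comm]

theorem stationaryMean_sum (I : FeedbackMAB n) {ι : Type*} (A : Finset ι)
    (f : ι → (Fin n → Bool) → ℝ) :
    I.stationaryMean (∑ a ∈ A, f a) = ∑ a ∈ A, I.stationaryMean (f a) := by
  simp only [stationaryMean, Finset.sum_apply, Finset.mul_sum]
  exact Finset.sum_comm

/-- Both sides are the limit of the same sequence of expectations, up to a shift by `t`. -/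
theorem stationaryMean_expect (I : FeedbackMAB n) (t : ℕ) (f : (Fin n → Bool) → ℝ) :
    I.stationaryMean (I.expect t f) = I.stationaryMean f := by
  refine tendsto_nhds_unique (I.tendsto_expect (I.expect t f) fun _ => true) ?_
  simp only [expect_expect]
  exact (I.tendsto_expect f _).comp (tendsto_add_atTop_nat t)

theorem stationaryMean_prod (I : FeedbackMAB n) (f : Fin n → Bool → ℝ) :
    I.stationaryMean (fun s => ∏ i, f i (s i)) = ∏ i, ∑ b, I.stationary i b * f i b := by
  rw [← sum_prod_eq_prod_sum fun i b => I.stationary i b * f i b]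
  simp only [stationaryMean, Finset.prod_mul_distrib]

theorem stationaryMean_one (I : FeedbackMAB n) : I.stationaryMean 1 = 1 := by
  have h := I.stationaryMean_prod fun _ _ => 1
  simp only [Finset.prod_const_one, mul_one, Fintype.sum_bool, stationary_add] at h
  exact h

/-! ### A policy that explores and then exploits, in blocks of fixed length -/

open Classical in
/-- The rule that, in each block of `L` steps, plays all arms in turn, and then, to the end of
the block, an arm that was seen in the good state in this block. -/
noncomputable def blockRule (n L : ℕ) (h : List (Record n)) : Option (Fin n) :=
  if hk : h.length % L < n then some ⟨h.length % L, hk⟩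
  else if hx : ∃ i, some (i, true) ∈ h.take (h.length % L) then some hx.choose
  else none

/-- Some arm is good in state `s`, and the last `k` records are those of the first `k` arms (at
least) in this state. -/
def Informed (k : ℕ) (h : List (Record n)) (s : Fin n → Bool) : Prop :=
  (∃ i, s i = true) ∧ (∀ i b, some (i, b) ∈ h.take k → s i = b) ∧
    ∀ i : Fin n, i.val < k → some (i, s i) ∈ h.take k

/-- Records are stored latest first, so for `k = h.length % L` the list `h.take k` is the history of
the current block. If the state persists, a new record is again truthful, and step `k < n` adds arm
`k`. -/
theorem Informed.cons {L k : ℕ} {h : List (Record n)} {s : Fin n → Bool} (hs : Informed k h s)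
    (hk : h.length % L = k) : Informed (k + 1) (record (blockRule n L h) s :: h) s := by
  obtain ⟨h1, h2, h3⟩ := hs
  refine ⟨h1, fun i b hb => ?_, fun i hi => ?_⟩
  · rw [List.take_succ_cons, List.mem_cons] at hb
    rcases hb with hb | hb
    · rcases ha : blockRule n L h with _ | j
      · simp [ha, record] at hb
      · simp only [ha, record, Option.map_some, Option.some.injEq, Prod.mk.injEq] at hb
        rw [hb.1, hb.2]
    · exact h2 i b hb
  · rw [List.take_succ_cons, List.mem_cons]
    rcases Nat.lt_succ_iff_lt_or_eq.1 hi with hi | hi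
    · exact .inr (h3 i hi)
    · left
      have hn : h.length % L < n := by rw [hk, ← hi]; exact i.2
      have : blockRule n L h = some i := by
        rw [blockRule, dif_pos hn]
        exact congrArg some (Fin.ext (hk.trans hi.symm))
      rw [this]
      rfl

open Classical in
/-- The number of plays of good arms to come in a block of length `L` after its first `k` steps,
if the state `s` persists. -/
noncomputable def playsToCome (L k : ℕ) (h : List (Record n)) (s : Fin n → Bool) : ℝ :=
  if Informed k h s then (L : ℝ) - (max k n : ℕ) else 0

theorem playsToCome_nonneg {L k : ℕ} (hL : n ≤ L) (hk : k ≤ L) (h : List (Record n))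
    (s : Fin n → Bool) : 0 ≤ playsToCome L k h s := by
  unfold playsToCome
  split_ifs
  · exact sub_nonneg.2 (Nat.cast_le.2 (max_le hk hL))
  · exact le_rfl

/-- The increment of `max k n` is `0` while exploring, where rewards are simply ignored, and `1`
afterwards, where the rule finds an arm recorded as good in the unchanged state. -/
theorem Informed.le_reward (I : FeedbackMAB n) (hr : ∀ i, I.r i = 1) {L k : ℕ}
    {h : List (Record n)} {s : Fin n → Bool} (hs : Informed k h s) (hk : h.length % L = k) :
    ((max (k + 1) n : ℕ) : ℝ) - (max k n : ℕ) ≤ I.reward (blockRule n L h) s := by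
  subst hk
  rcases lt_or_ge (h.length % L) n with hkn | hkn
  · rw [max_eq_right hkn.le, max_eq_right (Nat.succ_le_of_lt hkn), sub_self]
    exact I.reward_nonneg _ _
  · obtain ⟨⟨i, hi⟩, h4, h5⟩ := hs
    have hx : ∃ i, some (i, true) ∈ h.take (h.length % L) :=
      ⟨i, by rw [← hi]; exact h5 i (i.2.trans_le hkn)⟩
    rw [max_eq_left hkn, max_eq_left (by omega), blockRule, dif_neg (by omega), dif_pos hx]
    simp only [reward]
    rw [if_pos (h4 _ _ hx.choose_spec), hr]
    push_cast
    linarith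

/-- The probability that the joint state changes in the next step. -/
noncomputable def changeProb (I : FeedbackMAB n) (s : Fin n → Bool) : ℝ := 1 - I.jointTrans s s

theorem changeProb_nonneg (I : FeedbackMAB n) (s : Fin n → Bool) : 0 ≤ I.changeProb s :=
  sub_nonneg.2 <| (Finset.single_le_sum (fun s' _ => I.jointTrans_nonneg s s')
    (Finset.mem_univ s)).trans_eq (I.sum_jointTrans s)

/-- `playsToCome` acts as a potential. If the state persists, its drop is paid for by the reward; if
the state changes, at most `L` is lost, whence the error `L * changeProb`. -/
theorem playsToCome_le (I : FeedbackMAB n) (hr : ∀ i, I.r i = 1) {L k : ℕ} (hL : n ≤ L)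
    (hkL : k < L) {h : List (Record n)} (hk : h.length % L = k) (s : Fin n → Bool) :
    playsToCome L k h s ≤ I.reward (blockRule n L h) s +
      ∑ s', I.jointTrans s s' * playsToCome L (k + 1) (record (blockRule n L h) s :: h) s' +
      L * I.changeProb s := by
  have h0 : ∀ s' ∈ Finset.univ, 0 ≤ I.jointTrans s s' *
      playsToCome L (k + 1) (record (blockRule n L h) s :: h) s' := fun s' _ =>
    mul_nonneg (I.jointTrans_nonneg s s') (playsToCome_nonneg hL hkL _ _)
  have hc := I.changeProb_nonneg s
  by_cases hs : Informed k h s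
  -- Of the possible next states only `s' = s` is kept.
  · have h1 := Finset.single_le_sum h0 (Finset.mem_univ s)
    have h2 := hs.le_reward I hr hk
    rw [playsToCome, if_pos (hs.cons hk)] at h1
    rw [playsToCome, if_pos hs]
    have h3 : (0 : ℝ) ≤ (max (k + 1) n : ℕ) := Nat.cast_nonneg _
    have h4 : I.jointTrans s s = 1 - I.changeProb s := by rw [changeProb]; ring
    rw [h4] at h1
    nlinarith [mul_nonneg hc h3]
  · rw [playsToCome, if_neg hs]
    have h1 := Finset.sum_nonneg h0
    have h2 := I.reward_nonneg (blockRule n L h) s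
    positivity

/-- `R` steps of the block remain, and `W` bounds from below what is earned after it. Induction on
`R` sums the errors of `playsToCome_le` over these steps. The condition on `h.length` is taken
modulo `L` so that `k = L` is the start of the next block. -/
theorem le_totalReward_blockRule (I : FeedbackMAB n) (hr : ∀ i, I.r i = 1) {L : ℕ} (hL : n ≤ L)
    {T : ℕ} {W : (Fin n → Bool) → ℝ}
    (hW : ∀ h : List (Record n), h.length % L = 0 →
      ∀ s, W s ≤ I.totalReward (deterministic (blockRule n L)) T h s)
    (R k : ℕ) (hk : k + R = L) (h : List (Record n)) (hh : h.length % L = k % L)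
    (s : Fin n → Bool) :
    playsToCome L k h s - L * ∑ j ∈ Finset.range R, I.expect j I.changeProb s + I.expect R W s ≤
      I.totalReward (deterministic (blockRule n L)) (R + T) h s := by
  induction R generalizing k h s with
  | zero =>
    obtain rfl : k = L := by omega
    have h1 : playsToCome k k h s ≤ 0 := by
      unfold playsToCome
      split_ifs
      · exact sub_nonpos.2 (Nat.cast_le.2 (le_max_left k n))
      · exact le_rfl
    have h2 := hW h (by rw [hh, Nat.mod_self]) s
    rw [expect_zero, Finset.sum_range_zero, mul_zero, zero_add]
    linarith
  | succ R ih =>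
    have hkL : k < L := by omega
    rw [Nat.mod_eq_of_lt hkL] at hh
    rw [Nat.add_right_comm, totalReward_deterministic_succ]
    have h1 : ∀ s', _ := ih (k + 1) (by omega) (record (blockRule n L h) s :: h)
      (by rw [List.length_cons, ← Nat.mod_add_mod, hh])
    have h2 := Finset.sum_le_sum fun s' (_ : s' ∈ Finset.univ) =>
      mul_le_mul_of_nonneg_left (h1 s') (I.jointTrans_nonneg s s')
    have h3 : ∑ s', I.jointTrans s s' * ∑ j ∈ Finset.range R, I.expect j I.changeProb s' =
        ∑ j ∈ Finset.range R, I.expect (j + 1) I.changeProb s := by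
      simp only [Finset.mul_sum, ← sum_jointTrans_mul_expect]
      exact Finset.sum_comm
    simp only [mul_add, mul_sub, Finset.sum_add_distrib, Finset.sum_sub_distrib,
      sum_jointTrans_mul_expect, mul_left_comm _ (L : ℝ), ← Finset.mul_sum, h3] at h2
    have h4 := I.playsToCome_le hr hL hkL hh s
    rw [Finset.sum_range_succ', expect_zero]
    linarith

open Classical in
/-- The indicator function of the states with a good arm. -/
noncomputable def someGood (s : Fin n → Bool) : ℝ := if ∃ i, s i = true then 1 else 0

/-- A lower bound for the reward of `blockRule` in a block, by the state at its beginning. -/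
noncomputable def blockBound (I : FeedbackMAB n) (L : ℕ) : (Fin n → Bool) → ℝ :=
  ((L : ℝ) - n) • someGood - (L : ℝ) • ∑ j ∈ Finset.range L, I.expect j I.changeProb

/-- Blocks are glued by taking for `W` the bound for the `m` later blocks. The rule uses only
records of the current block, so the earlier history is arbitrary. -/
theorem sum_blockBound_le (I : FeedbackMAB n) (hr : ∀ i, I.r i = 1) {L : ℕ} (hL : n ≤ L)
    (m : ℕ) (h : List (Record n)) (hh : h.length % L = 0) (s : Fin n → Bool) :
    (∑ j ∈ Finset.range m, I.expect (j * L) (I.blockBound L)) s ≤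
      I.totalReward (deterministic (blockRule n L)) (m * L) h s := by
  induction m generalizing h s with
  | zero => simp [totalReward]
  | succ m ih =>
    have h1 := I.le_totalReward_blockRule hr hL ih L 0 (zero_add L) h (by simpa using hh) s
    rw [expect_sum] at h1
    rw [Finset.sum_range_succ', Nat.succ_mul, Nat.add_comm (m * L) L]
    refine le_trans (le_of_eq ?_) h1
    -- At the start of a block `Informed` asks only for a good arm.
    have h2 : (playsToCome L 0 h s : ℝ) = ((L : ℝ) - n) * someGood s := by
      simp [playsToCome, someGood, Informed]
    rw [h2]
    simp only [expect_expect, zero_mul, expect_zero, blockBound, Pi.add_apply, Pi.sub_apply,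
      Pi.smul_apply, smul_eq_mul, Finset.sum_apply, add_mul, one_mul, add_comm L]
    ring

/-- By stationarity the mean of `blockBound` is `(L - n)` times that of `someGood` minus `L ^ 2`
times that of `changeProb`; dividing by `L` gives the rate per step. -/
theorem le_longRunReward_blockRule (I : FeedbackMAB n) (hr : ∀ i, I.r i = 1) {L : ℕ}
    (hL : n ≤ L) (hL0 : 0 < L) (f : (Fin n → Bool) → ℝ) (hf : ∀ a s, I.reward a s ≤ f s)
    (μ : stdSimplex ℝ (Fin n → Bool)) :
    (1 - n / L) * I.stationaryMean someGood - L * I.stationaryMean I.changeProb ≤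
      I.longRunReward μ (deterministic (blockRule n L)) := by
  have hL' : (L : ℝ) ≠ 0 := by positivity
  have h1 := (I.tendsto_cesaro_expect μ hL0 (I.blockBound L)).div_const (L : ℝ)
  rw [blockBound, stationaryMean_sub, stationaryMean_smul, stationaryMean_smul,
    stationaryMean_sum] at h1
  simp only [stationaryMean_expect, Finset.sum_const, Finset.card_range, nsmul_eq_mul] at h1
  refine I.le_longRunReward f hf μ _ hL0 _ _ (h1.trans_eq ?_) fun m => ?_
  · congr 1
    field_simp
  · have := I.le_averageReward μ (deterministic (blockRule n L)) (m * L) _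
      (I.sum_blockBound_le hr hL m [] (by simp))
    simp only [Finset.sum_apply] at this
    push_cast at this
    rwa [← div_div] at this

/-! ### Unit rewards: stationary means and elementary bounds -/

theorem reward_le_someGood (I : FeedbackMAB n) (hr : ∀ i, I.r i = 1) (a : Option (Fin n))
    (s : Fin n → Bool) : I.reward a s ≤ someGood s := by
  unfold someGood
  rcases a with _ | i
  · simp only [reward]
    split_ifs
    exacts [zero_le_one, le_rfl]
  · simp only [reward, hr]
    split_ifs with h1 h2
    exacts [le_rfl, absurd ⟨i, h1⟩ h2, zero_le_one, le_rfl]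

/-- The indicator that all arms are bad is a product over the independent arms. -/
theorem stationaryMean_someGood (I : FeedbackMAB n) :
    I.stationaryMean someGood = 1 - ∏ i, I.stationary i false := by
  have h : (someGood : (Fin n → Bool) → ℝ) =
      1 - fun s => ∏ i, if s i = false then (1 : ℝ) else 0 := by
    funext s
    rw [Pi.sub_apply, Pi.one_apply, Finset.prod_ite_zero, Finset.prod_const_one, someGood]
    by_cases hs : ∃ i, s i = true
    · rw [if_pos hs, if_neg (by simpa using hs), sub_zero]
    · rw [if_neg hs, if_pos (by simpa using hs), sub_self]
  rw [h, stationaryMean_sub, stationaryMean_one,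
    I.stationaryMean_prod fun _ b => if b = false then 1 else 0]
  simp

theorem stationaryMean_changeProb (I : FeedbackMAB n) :
    I.stationaryMean I.changeProb = 1 - ∏ i, ∑ b, I.stationary i b * I.transMatrix i b b := by
  rw [← I.stationaryMean_prod fun i b => I.transMatrix i b b]
  conv_rhs => rw [← I.stationaryMean_one, ← stationaryMean_sub]
  rfl

/-- Playing the same arm in every step already gives a positive average reward. -/
theorem policyOpt_pos (I : FeedbackMAB n) (hr : ∀ i, I.r i = 1) (i : Fin n)
    (μ : stdSimplex ℝ (Fin n → Bool)) : 0 < I.policyOpt μ := by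
  have hf := I.reward_le_someGood hr
  refine lt_of_lt_of_le ?_ ((I.stationaryMean_reward_le_longRunReward _ hf μ (some i)).trans
    ((I.isLUB_policyOpt _ hf μ).1 ⟨_, rfl⟩))
  have hp : ∀ s : Fin n → Bool, 0 < ∏ i, I.stationary i (s i) := fun s =>
    Finset.prod_pos fun j _ => I.stationary_pos j (s j)
  refine Finset.sum_pos' (fun s _ => mul_nonneg (hp s).le (I.reward_nonneg _ _))
    ⟨fun _ => true, Finset.mem_univ _, mul_pos (hp _) ?_⟩
  simp [reward, hr]

theorem whittleValues_le_one (I : FeedbackMAB n) (hr : ∀ i, I.r i = 1) :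
    1 ∈ upperBounds I.whittleValues := by
  rintro _ ⟨x, hx, rfl⟩
  rw [← hx.plays, whittleObjective]
  refine Finset.sum_le_sum fun i _ => ?_
  rw [Fintype.sum_bool]
  simp only [hr, one_mul]
  exact le_add_of_nonneg_right (tsum_nonneg fun t => hx.nonneg i false t)

/-! ### Identical arms -/

section Identical

variable {β : ℝ} (hn : 2 ≤ n) (hβ : 0 < β) (h : (n : ℝ) * β < n - 1)

theorem iid_stationary_true (i : Fin n) : (iid n β hn hβ h).stationary i true = 1 / n := by
  have h2 : (2 : ℝ) ≤ n := by exact_mod_cast hn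
  have h1 : (n : ℝ) - 1 ≠ 0 := by linarith
  have h0 : (n : ℝ) ≠ 0 := by linarith
  have h3 : β / ((n : ℝ) - 1) + β = β / (n - 1) * n := by
    field_simp
    ring
  simp only [stationary, iid, if_true]
  rw [h3, div_mul_cancel_left₀ (div_ne_zero hβ.ne' h1), one_div]

theorem iid_stationary_false (i : Fin n) : (iid n β hn hβ h).stationary i false = 1 - 1 / n := by
  rw [← iid_stationary_true hn hβ h i, ← stationary_add _ i]
  ring

theorem iid_mean_someGood :
    (iid n β hn hβ h).stationaryMean someGood = 1 - (1 - 1 / (n : ℝ)) ^ n := by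
  simp [stationaryMean_someGood, iid_stationary_false]

/-- In stationarity an arm moves from good to bad and from bad to good with probability `β / n`
each, so it stays put with probability `1 - 2 β / n`. Bernoulli's inequality handles the `n` arms
together. -/
theorem iid_mean_changeProb_le :
    (iid n β hn hβ h).stationaryMean (iid n β hn hβ h).changeProb ≤ 2 * β := by
  have h2 : (2 : ℝ) ≤ n := by exact_mod_cast hn
  have h1 : (n : ℝ) - 1 ≠ 0 := by linarith
  have h0 : (0 : ℝ) < n := by linarith
  have h3 : ∀ i, ∑ b, (iid n β hn hβ h).stationary i b * (iid n β hn hβ h).transMatrix i b b =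
      1 + -(2 * β / n) := fun i => by
    rw [Fintype.sum_bool, iid_stationary_true, iid_stationary_false]
    simp only [transMatrix, iid, Matrix.of_apply]
    field_simp
    ring
  have h4 : -2 ≤ -(2 * β / n) := by
    rw [neg_le_neg_iff, div_le_iff₀ h0]
    nlinarith
  have h5 := one_add_mul_le_pow h4 n
  rw [stationaryMean_changeProb]
  simp only [h3, Finset.prod_const, Finset.card_univ, Fintype.card_fin]
  have h6 : (n : ℝ) * -(2 * β / n) = -(2 * β) := by field_simp
  linarith

/-! ### Identical arms: the value of Whittle's LP -/

theorem iid_v (i : Fin n) (t : ℕ) :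
    (iid n β hn hβ h).v i t = (1 - (1 - n * β / (n - 1)) ^ t) / n := by
  have h2 : (2 : ℝ) ≤ n := by exact_mod_cast hn
  have h1 : (n : ℝ) - 1 ≠ 0 := by linarith
  have h3 : 1 - (iid n β hn hβ h).α i - (iid n β hn hβ h).β i = 1 - n * β / (n - 1) := by
    simp only [iid]
    field_simp
    ring
  rw [v, transMatrix_pow_apply, h3, iid_stationary_true]
  simp only [Bool.false_eq_true, if_false]
  ring

theorem iid_u_one (i : Fin n) : (iid n β hn hβ h).u i 1 = 1 - β := by
  simp [u, iid, transMatrix]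

/-- The solution of Whittle's LP that plays an arm again at once if it was good, and after `t`
steps if it was bad. -/
theorem iid_mem_whittleValues (t : ℕ+) {D : ℝ} (hD : D = 1 - (1 - n * β / (n - 1)) ^ (t : ℕ))
    (hD0 : 0 < D) (ht : ((t : ℝ) - n) * (n * β / (n - 1)) ≤ D) :
    1 / (1 + n * β / D) ∈ (iid n β hn hβ h).whittleValues := by
  have h2 : (2 : ℝ) ≤ n := by exact_mod_cast hn
  have h1 : 0 < (n : ℝ) - 1 := by linarith
  have h0 : (0 : ℝ) < n := by linarith
  -- Here `y` is the number of bad plays per good play, forced by the balance equation `y * (D / n)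
  -- = β`; then `a`, the rate of good plays of each arm, is forced by `n * a * (1 + y) = 1`.
  obtain ⟨y, hy⟩ : ∃ y, y = n * β / D := ⟨_, rfl⟩
  have hy0 : 0 < y := by rw [hy]; positivity
  obtain ⟨a, ha⟩ : ∃ a, a = 1 / (n * (1 + y)) := ⟨_, rfl⟩
  have ha0 : 0 < a := by rw [ha]; positivity
  have hsum : ∀ (t₀ : ℕ+) (c : ℝ) (f : ℕ+ → ℝ),
      HasSum (fun t => f t * if t = t₀ then c else 0) (f t₀ * c) := fun t₀ c f => by
    simpa using hasSum_single (f := fun t => f t * if t = t₀ then c else 0) t₀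
      fun t ht => by simp [ht]
  have hsum1 : ∀ (t₀ : ℕ+) (c : ℝ), ∑' t : ℕ+, (if t = t₀ then c else 0) = c := fun t₀ c =>
    tsum_ite_eq t₀ _
  refine ⟨fun _ s t' => if s then (if t' = 1 then a else 0) else if t' = t then a * y else 0,
    ⟨fun i s t' => ?_, fun i s => ?_, ?_, fun i => ?_, fun i => ?_⟩, ?_⟩
  · split_ifs <;> positivity
  · cases s
    · simpa using (hsum t (a * y) fun t => t).summable
    · simpa using (hsum 1 a fun t => t).summable
  · simp only [Fintype.sum_bool, if_true, Bool.false_eq_true, if_false, hsum1, Finset.sum_const,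
      Finset.card_univ, Fintype.card_fin, nsmul_eq_mul]
    rw [ha]
    field_simp
  · simp only [Fintype.sum_bool, if_true, Bool.false_eq_true, if_false]
    rw [(hsum 1 a fun t => t).tsum_eq, (hsum t (a * y) fun t => t).tsum_eq]
    -- This is the time constraint `a * (1 + t * y) ≤ 1` with `a` substituted.
    have h3 : ((t : ℝ) - n) * y ≤ n - 1 := by
      rw [hy, mul_div_assoc', div_le_iff₀ hD0]
      rw [mul_div_assoc', div_le_iff₀ h1] at ht
      linarith
    have h4 : a * (n * (1 + y)) = 1 := by rw [ha]; field_simp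
    push_cast
    nlinarith
  · simp only [if_true, Bool.false_eq_true, if_false]
    simp only [mul_comm (ite _ _ _)]
    rw [(hsum t (a * y) _).tsum_eq, (hsum 1 a _).tsum_eq]
    rw [PNat.one_coe, iid_u_one, iid_v, ← hD, hy]
    field_simp
    ring
  · rw [whittleObjective]
    have hr : ∀ i, (iid n β hn hβ h).r i = 1 := fun _ => rfl
    simp only [hr, one_mul, if_true, hsum1, Finset.sum_const, Finset.card_univ, Fintype.card_fin,
      nsmul_eq_mul]
    rw [ha, ← hy]
    field_simp

/-- A long wait `t` makes a bad arm likelier to have recovered, but the time constraint limits it.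
With `t = ⌊√(n / θ)⌋` and `x = t θ`, the bound `x ^ 2 ≤ n θ` gives feasibility, and `n β ≤ n θ ≤ 4 x
^ 2` keeps bad plays rare. -/
theorem exists_iid_whittleValue :
    ∃ w ∈ (iid n β hn hβ h).whittleValues, 1 - 3 * √(n * β) ≤ w := by
  have h2 : (2 : ℝ) ≤ n := by exact_mod_cast hn
  have h1 : 0 < (n : ℝ) - 1 := by linarith
  have h0 : (0 : ℝ) < n := by linarith
  obtain ⟨θ, hθ⟩ : ∃ θ, θ = n * β / ((n : ℝ) - 1) := ⟨_, rfl⟩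
  have hθ0 : 0 < θ := by rw [hθ]; positivity
  have hθ1 : θ < 1 := by rwa [hθ, div_lt_one h1]
  have hβθ : n * β ≤ n * θ := by
    rw [hθ, mul_div_assoc', le_div_iff₀ h1]
    nlinarith [mul_pos h0 hβ]
  have hz : 1 ≤ √(n / θ) := by
    rw [Real.one_le_sqrt, le_div_iff₀ hθ0]
    linarith
  have hz2 : √(n / θ) ^ 2 * θ = n := by
    rw [Real.sq_sqrt (by positivity)]
    field_simp
  obtain ⟨t, ht0, ht⟩ : ∃ t : ℕ, 0 < t ∧ t = ⌊√(n / θ)⌋₊ :=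
    ⟨_, Nat.floor_pos.2 hz, rfl⟩
  have ht1 : (t : ℝ) ≤ √(n / θ) := ht ▸ Nat.floor_le (by positivity)
  have ht2 : √(n / θ) < t + 1 := ht ▸ Nat.lt_floor_add_one _
  have ht3 : (1 : ℝ) ≤ t := by exact_mod_cast ht0
  have ht4 : (t : ℝ) ^ 2 * θ ≤ n := by
    rw [← hz2]
    gcongr
  have ht5 : (n : ℝ) ≤ (2 * t) ^ 2 * θ := by
    rw [← hz2]
    gcongr
    linarith
  obtain ⟨x, hx⟩ : ∃ x, x = t * θ := ⟨_, rfl⟩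
  have hx0 : 0 < x := by rw [hx]; positivity
  obtain ⟨D, hD⟩ : ∃ D, D = 1 - (1 - θ) ^ t := ⟨_, rfl⟩
  -- That is `D ≥ x / (1 + x)`: Bernoulli gives `1 + x ≤ (1 + θ) ^ t`, and `(1 - θ) ^ t * (1 + θ) ^
  -- t ≤ 1`.
  have hDx : x ≤ D * (1 + x) := by
    have h3 : (1 - θ) ^ t * (1 + x) ≤ 1 := calc
      (1 - θ) ^ t * (1 + x) ≤ (1 - θ) ^ t * (1 + θ) ^ t := by
        rw [hx]
        exact mul_le_mul_of_nonneg_left (one_add_mul_le_pow (by linarith) t)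
          (pow_nonneg (by linarith) t)
      _ = (1 - θ ^ 2) ^ t := by rw [← mul_pow]; ring
      _ ≤ 1 := pow_le_one₀ (by nlinarith) (by nlinarith)
    rw [hD]
    linarith
  have hD0 : 0 < D := pos_of_mul_pos_left (hx0.trans_le hDx) (by linarith)
  refine ⟨_, iid_mem_whittleValues hn hβ h ⟨t, ht0⟩ (by rw [hD, hθ]; rfl) hD0 ?_, ?_⟩
  · rw [← hθ]
    change ((t : ℝ) - n) * θ ≤ D
    have h3 : x ^ 2 ≤ n * θ := by
      rw [hx]
      nlinarith
    have h4 : ((t : ℝ) - n) * θ * (1 + x) ≤ D * (1 + x) := by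
      refine le_trans ?_ hDx
      rw [sub_mul, ← hx]
      nlinarith [mul_pos (mul_pos h0 hθ0) hx0]
    exact le_of_mul_le_mul_right h4 (by linarith)
  · have hq0 : 0 < √(n * β) := by positivity
    have hq2 : √(n * β) ^ 2 = n * β := Real.sq_sqrt (by positivity)
    set q := √(n * β)
    rw [← hq2]
    have hy0 : 0 < q ^ 2 / D := by positivity
    -- For `q ≤ 1` the ratio of bad to good plays is at most `q * (2 + q) ≤ 3 * q`, the source of
    -- the constant `3`. For `q > 1` the claimed lower bound is negative.
    rcases le_or_gt q 1 with hq1 | hq1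
    · have h3 : q ≤ 2 * x := by
        refine (pow_le_pow_iff_left₀ hq0.le (by linarith) two_ne_zero).1 ?_
        rw [hq2, hx]
        linarith [mul_le_mul_of_nonneg_right ht5 hθ0.le]
      have h4 : q ≤ D * (2 + q) := by
        have h5 : q * (1 + x) ≤ (D * (2 + q)) * (1 + x) := by
          linarith [mul_le_mul_of_nonneg_right hDx (show 0 ≤ 2 + q by linarith)]
        exact le_of_mul_le_mul_right h5 (by linarith)
      have h6 : q ^ 2 / D ≤ 3 * q := by
        rw [div_le_iff₀ hD0]
        linarith [mul_le_mul_of_nonneg_left h4 hq0.le,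
          mul_le_mul_of_nonneg_left hq1 (mul_pos hq0 hD0).le]
      rw [le_div_iff₀ (by linarith)]
      linarith [mul_pos hq0 hy0]
    · have : 0 < 1 / (1 + q ^ 2 / D) := by positivity
      linarith

theorem iid_isLUB_whittleOpt :
    IsLUB (iid n β hn hβ h).whittleValues (iid n β hn hβ h).whittleOpt :=
  have ⟨w, hw, _⟩ := exists_iid_whittleValue hn hβ h
  isLUB_csSup ⟨w, hw⟩ ⟨1, whittleValues_le_one _ fun _ => rfl⟩

theorem iid_whittleOpt_le_one : (iid n β hn hβ h).whittleOpt ≤ 1 :=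
  (iid_isLUB_whittleOpt hn hβ h).2 (whittleValues_le_one _ fun _ => rfl)

theorem le_iid_whittleOpt : 1 - 3 * √(n * β) ≤ (iid n β hn hβ h).whittleOpt :=
  have ⟨_, hw, hw'⟩ := exists_iid_whittleValue hn hβ h
  hw'.trans ((iid_isLUB_whittleOpt hn hβ h).1 hw)

/-! ### Identical arms: the value of an optimal policy -/

variable (μ : stdSimplex ℝ (Fin n → Bool))

theorem iid_longRunReward_le (π : Policy n) :
    (iid n β hn hβ h).longRunReward μ π ≤ 1 - (1 - 1 / (n : ℝ)) ^ n := by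
  rw [← iid_mean_someGood hn hβ h]
  exact longRunReward_le _ _ (reward_le_someGood _ fun _ => rfl) μ π

theorem iid_isLUB_policyOpt :
    IsLUB (Set.range ((iid n β hn hβ h).longRunReward μ)) ((iid n β hn hβ h).policyOpt μ) :=
  isLUB_policyOpt _ _ (reward_le_someGood _ fun _ => rfl) μ

theorem iid_policyOpt_le : (iid n β hn hβ h).policyOpt μ ≤ 1 - (1 - 1 / (n : ℝ)) ^ n :=
  (iid_isLUB_policyOpt hn hβ h μ).2 (by rintro _ ⟨π, rfl⟩; exact iid_longRunReward_le hn hβ h μ π)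

theorem le_iid_policyOpt {K : ℕ} (hK : 0 < K) :
    (1 - (1 - 1 / (n : ℝ)) ^ n) - 1 / K - 2 * K * (n * β) ≤ (iid n β hn hβ h).policyOpt μ := by
  have h2 : (2 : ℝ) ≤ n := by exact_mod_cast hn
  have h0 : (0 : ℝ) < n := by linarith
  have hK' : (0 : ℝ) < K := by exact_mod_cast hK
  have h3 := le_longRunReward_blockRule (iid n β hn hβ h) (fun _ => rfl) (L := n * K)
    (Nat.le_mul_of_pos_right n hK) (by positivity) someGood (reward_le_someGood _ fun _ => rfl) μ
  refine le_trans ?_ (h3.trans ((iid_isLUB_policyOpt hn hβ h μ).1 ⟨_, rfl⟩))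
  have h4 : (n : ℝ) / (n * K : ℕ) = 1 / K := by push_cast; field_simp
  rw [iid_mean_someGood, h4]
  have h5 := mul_le_mul_of_nonneg_left (iid_mean_changeProb_le hn hβ h)
    (Nat.cast_nonneg (α := ℝ) (n * K))
  have h6 : 0 ≤ 1 - 1 / (n : ℝ) := by
    rw [sub_nonneg, div_le_one h0]
    linarith
  -- With `p = 1 - (1 - 1/n)^n ≤ 1`, the exploration loss `p / K` is at most `1 / K`.
  have h7 : 0 ≤ 1 / (K : ℝ) * (1 - 1 / (n : ℝ)) ^ n := by positivity
  push_cast at h5 ⊢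
  linarith

end Identical

/-! ### The limit of the gap -/

theorem tendsto_one_sub_pow :
    Tendsto (fun n : ℕ => 1 - (1 - 1 / (n : ℝ)) ^ n) atTop (𝓝 (1 - 1 / Real.exp 1)) := by
  have h := (Real.tendsto_one_add_div_pow_exp (-1)).const_sub 1
  rw [Real.exp_neg, ← one_div] at h
  exact h.congr fun n => by rw [neg_div, ← sub_eq_add_neg]

theorem gap_close {ε : ℝ} (hε : 0 < ε) : ∃ N : ℕ, ∃ κ : ℝ, 0 < κ ∧
    ∀ (n : ℕ) (β : ℝ) (hn : 2 ≤ n) (hβ : 0 < β) (h : (n : ℝ) * β < n - 1)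
      (μ : stdSimplex ℝ (Fin n → Bool)), N ≤ n → (n : ℝ) * β < κ →
      |(iid n β hn hβ h).gap μ - Real.exp 1 / (Real.exp 1 - 1)| < ε := by
  have he : 1 < Real.exp 1 := Real.one_lt_exp_iff.2 one_pos
  have hp : 0 < 1 - 1 / Real.exp 1 := by
    rw [sub_pos, div_lt_one (by linarith)]
    exact he
  have hc : ContinuousAt (fun p : ℝ × ℝ => p.1 / p.2) (1, 1 - 1 / Real.exp 1) :=
    continuousAt_fst.div continuousAt_snd hp.ne'
  obtain ⟨δ, hδ, hc⟩ := Metric.continuousAt_iff.1 hc ε hε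
  obtain ⟨N, hN⟩ := Metric.tendsto_atTop.1 tendsto_one_sub_pow (δ / 3) (by positivity)
  obtain ⟨k, hk⟩ := exists_nat_one_div_lt (show 0 < δ / 3 by positivity)
  have hk1 : (0 : ℝ) < (k : ℝ) + 1 := by positivity
  -- The block parameter `K = k + 1` depends on `δ` only and is fixed before `κ`. The first term of
  -- the minimum makes `3 * √(n β) < δ` for the LP, the second makes `2 * K * n * β < δ / 3`. For
  -- the policies, `N`, `1 / K` and this last loss each use a third of `δ`.
  refine ⟨N, min ((δ / 3) ^ 2) (δ / 3 / (2 * (k + 1))), by positivity,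
    fun n β hn hβ h μ hNn hκ => ?_⟩
  have h1 : √((n : ℝ) * β) < δ / 3 :=
    (Real.sqrt_lt' (by positivity)).2 (hκ.trans_le (min_le_left _ _))
  have h2 : 2 * ((k : ℝ) + 1) * (n * β) < δ / 3 := by
    rw [mul_comm]
    exact (lt_div_iff₀ (by positivity)).1 (hκ.trans_le (min_le_right _ _))
  have h3 := abs_lt.1 ((Real.dist_eq _ _).symm.trans_lt (hN n hNn))
  have h4 := le_iid_whittleOpt hn hβ h
  have h5 := iid_whittleOpt_le_one hn hβ h
  have h6 := iid_policyOpt_le hn hβ h μ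
  have h7 := le_iid_policyOpt hn hβ h μ k.succ_pos
  push_cast at h7
  have h8 := @hc ((iid n β hn hβ h).whittleOpt, (iid n β hn hβ h).policyOpt μ) (by
    rw [Prod.dist_eq, max_lt_iff, Real.dist_eq, Real.dist_eq, abs_lt, abs_lt]
    refine ⟨⟨?_, ?_⟩, ?_, ?_⟩ <;> dsimp only <;> linarith)
  rw [Real.dist_eq] at h8
  have h9 : Real.exp 1 / (Real.exp 1 - 1) = 1 / (1 - 1 / Real.exp 1) := by
    have : Real.exp 1 - 1 ≠ 0 := by linarith
    field_simp
  rw [h9]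
  exact h8

end FeedbackMAB

theorem mainTheorem6 :
    -- the gap is arbitrarily close to `e / (e - 1)`, for all large `n` and all small `n β`
    (∀ ε : ℝ, 0 < ε → ∃ N : ℕ, ∃ κ : ℝ, 0 < κ ∧
      ∀ (n : ℕ) (β : ℝ) (hn : 2 ≤ n) (hβ : 0 < β) (h : (n : ℝ) * β < n - 1)
        (μ : stdSimplex ℝ (Fin n → Bool)), N ≤ n → (n : ℝ) * β < κ →
        |(FeedbackMAB.iid n β hn hβ h).gap μ - Real.exp 1 / (Real.exp 1 - 1)| < ε) ∧
    -- the LP value is `1 - O(√(n β))`, and no policy gets more than `1 - (1 - 1 / n) ^ n`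
    (∃ C : ℝ, 0 < C ∧
      ∀ (n : ℕ) (β : ℝ) (hn : 2 ≤ n) (hβ : 0 < β) (h : (n : ℝ) * β < n - 1),
        IsLUB (FeedbackMAB.iid n β hn hβ h).whittleValues
          (FeedbackMAB.iid n β hn hβ h).whittleOpt ∧
        1 - C * √((n : ℝ) * β) ≤ (FeedbackMAB.iid n β hn hβ h).whittleOpt ∧
        (FeedbackMAB.iid n β hn hβ h).whittleOpt ≤ 1 ∧
        ∀ μ : stdSimplex ℝ (Fin n → Bool),
          IsLUB (Set.range ((FeedbackMAB.iid n β hn hβ h).longRunReward μ))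
            ((FeedbackMAB.iid n β hn hβ h).policyOpt μ) ∧
          0 < (FeedbackMAB.iid n β hn hβ h).policyOpt μ ∧
          ∀ π : FeedbackMAB.Policy n,
            (FeedbackMAB.iid n β hn hβ h).longRunReward μ π ≤ 1 - (1 - 1 / (n : ℝ)) ^ n) ∧
    Filter.Tendsto (fun n : ℕ => 1 - (1 - 1 / (n : ℝ)) ^ n) Filter.atTop
      (nhds (1 - 1 / Real.exp 1)) := by
  refine ⟨fun ε hε => FeedbackMAB.gap_close hε, ⟨3, by norm_num, fun n β hn hβ h =>
    ⟨FeedbackMAB.iid_isLUB_whittleOpt hn hβ h, FeedbackMAB.le_iid_whittleOpt hn hβ h,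
      FeedbackMAB.iid_whittleOpt_le_one hn hβ h, fun μ =>
      ⟨FeedbackMAB.iid_isLUB_policyOpt hn hβ h μ,
        FeedbackMAB.policyOpt_pos _ (fun _ => rfl) ⟨0, by omega⟩ μ,
        FeedbackMAB.iid_longRunReward_le hn hβ h μ⟩⟩⟩, FeedbackMAB.tendsto_one_sub_pow⟩
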